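/- Let $\mathbb{H}$ be the algebra of Hamilton quaternions over $\mathbb{R}$, with basis $1,i,j,k$; identify $\mathbb{R}$ with the scalar quaternions $\mathbb{R}\cdot 1$, and let $V=\{bi+cj+dk : b,c,d\in\mathbb{R}\}$ be the space of vector quaternions. Let $p\in\mathbb{R}\langle x_1,\dots,x_m\rangle$ be a polynomial in $m$ noncommuting variables with real coefficients, and suppose that $p$ is semihomogeneous of weighted degree $d\neq 0$ with integer weights $w_1,\dots,w_m$, that is, every monomial occurring in $p$ with nonzero coefficient satisfies $d_1w_1+\dots+d_mw_m=d$, where $d_j$ is its degree in $x_j$. Let $\operatorname{Im} p=\{p(a_1,\dots,a_m) : a_1,\dots,a_m\in\mathbb{H}\}$. Then $\operatorname{Im} p$ is either $\{0\}$, or $\mathbb{R}$, or $\mathbb{R}_{\ge 0}$, or $\mathbb{R}_{\le 0}$, or $V$, or a subset of $\mathbb{H}$ that is Zariski dense, where $\mathbb{H}$ is viewed as the real affine space $\mathbb{R}^4$ through the coordinates with respect to $1,i,j,k$. -/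

import Mathlib

open scoped Quaternion

noncomputable section

/-- Polynomials in `m` noncommuting variables with real coefficients: the free algebra
`ℝ⟨x₁, …, x_m⟩`. -/
abbrev NCPoly (m : ℕ) : Type := FreeAlgebra ℝ (Fin m)

/-- The monomials (words in the variables) that occur in `p` with a nonzero coefficient. -/
def NCPoly.monomials {m : ℕ} (p : NCPoly m) : Finset (FreeMonoid (Fin m)) :=
  (FreeAlgebra.equivMonoidAlgebraFreeMonoid p).coeff.support

/-- The degree of the variable `x_j` in a monomial `h`: the number of occurrences of `x_j`. -/
def monomialDegree {m : ℕ} (j : Fin m) (h : FreeMonoid (Fin m)) : ℕ :=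
  h.toList.count j

/-- `p` is semihomogeneous of weighted degree `d` with integer weights `w₁, …, w_m`: every monomial
`h` of `p`, of degree `d_j` in `x_j`, satisfies `d₁ w₁ + ⋯ + d_m w_m = d`. -/
def IsSemihomogeneous {m : ℕ} (w : Fin m → ℤ) (d : ℤ) (p : NCPoly m) : Prop :=
  ∀ h ∈ NCPoly.monomials p, ∑ j, (monomialDegree j h : ℤ) * w j = d

/-- The value `p(a₁, …, a_m)` of `p` at quaternions `a₁, …, a_m`. -/
def evalQuaternion {m : ℕ} (p : NCPoly m) (a : Fin m → ℍ[ℝ]) : ℍ[ℝ] :=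
  FreeAlgebra.lift ℝ a p

/-- The image of `p` evaluated on the quaternions. -/
def quaternionImage {m : ℕ} (p : NCPoly m) : Set ℍ[ℝ] :=
  Set.range (evalQuaternion p)

/-- The scalar quaternions. -/
def scalarQuaternions : Set ℍ[ℝ] := Set.range fun r : ℝ => (r : ℍ[ℝ])

/-- The nonnegative scalar quaternions. -/
def nonnegScalarQuaternions : Set ℍ[ℝ] := (fun r : ℝ => (r : ℍ[ℝ])) '' Set.Ici 0

/-- The nonpositive scalar quaternions. -/
def nonposScalarQuaternions : Set ℍ[ℝ] := (fun r : ℝ => (r : ℍ[ℝ])) '' Set.Iic 0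

/-- The space `V` of vector quaternions `b i + c j + d k`. -/
def vectorQuaternions : Set ℍ[ℝ] := {q | q.re = 0}

/-- Zariski closed subsets of `ℍ`, viewed as the real affine space `ℝ⁴` through the coordinates
`(a, b, c, d)` of `a + b i + c j + d k`: common zero sets of families of real polynomials. -/
def IsZariskiClosed (Z : Set ℍ[ℝ]) : Prop :=
  ∃ F : Set (MvPolynomial (Fin 4) ℝ),
    Z = {q | ∀ f ∈ F, MvPolynomial.eval ![q.re, q.imI, q.imJ, q.imK] f = 0}

/-- A subset of `ℍ` is Zariski dense if the only Zariski closed set containing it is `ℍ`. -/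
def IsZariskiDense (S : Set ℍ[ℝ]) : Prop :=
  ∀ Z : Set ℍ[ℝ], IsZariskiClosed Z → S ⊆ Z → Z = Set.univ

end

/-! The image contains 0 and is stable under positive scaling (semihomogeneity with `d ≠ 0`) and
under conjugation. Off the scalars it is therefore determined by the ratios of scalar part to vector
length that occur. Infinitely many ratios give Zariski density. If there are only finitely many, a
product of polynomials in the coordinates of the arguments vanishes. Since the polynomial ring is a
domain, either all values are scalar, or `re ^ 2 = c * vecNormSq` identically. A cone of scalars and
the case `c = 0` give the listed sets. For `c ≠ 0` a parity argument
(`eq_zero_of_mem_paritySubalgebra`) forces `p` to vanish on `ℍ`. -/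

open MvPolynomial

/-! ### Change of coefficient ring for quaternions -/

section QuaternionMap

variable {S T : Type*} [CommRing S] [CommRing T]

/-- The quaternion with the given coordinates. -/
def ofCoords (a b c d : S) : ℍ[S] := ⟨a, b, c, d⟩

@[simp] theorem re_ofCoords (a b c d : S) : (ofCoords a b c d).re = a := rfl
@[simp] theorem imI_ofCoords (a b c d : S) : (ofCoords a b c d).imI = b := rfl
@[simp] theorem imJ_ofCoords (a b c d : S) : (ofCoords a b c d).imJ = c := rfl
@[simp] theorem imK_ofCoords (a b c d : S) : (ofCoords a b c d).imK = d := rfl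

/-- The squared length of the vector part of a quaternion. -/
def vecNormSq (q : ℍ[S]) : S := q.imI ^ 2 + q.imJ ^ 2 + q.imK ^ 2

variable [Algebra ℝ S] [Algebra ℝ T]

/-- The homomorphism of quaternion algebras induced by a homomorphism of coefficient rings. -/
def quaternionMap (f : S →ₐ[ℝ] T) : ℍ[S] →ₐ[ℝ] ℍ[T] where
  toFun q := ofCoords (f q.re) (f q.imI) (f q.imJ) (f q.imK)
  map_one' := by ext <;> simp
  map_zero' := by ext <;> simp
  map_add' x y := by ext <;> simp
  map_mul' x y := by ext <;> simp
  commutes' r := by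
    ext <;> simp [Algebra.algebraMap_eq_smul_one]

theorem quaternionMap_apply (f : S →ₐ[ℝ] T) (q : ℍ[S]) :
    quaternionMap f q = ofCoords (f q.re) (f q.imI) (f q.imJ) (f q.imK) := rfl

theorem quaternionMap_lift {m : ℕ} (f : S →ₐ[ℝ] T) (a : Fin m → ℍ[S]) (p : NCPoly m) :
    quaternionMap f (FreeAlgebra.lift ℝ a p) =
      FreeAlgebra.lift ℝ (fun j => quaternionMap f (a j)) p := by
  have h : (quaternionMap f).comp (FreeAlgebra.lift ℝ a) =
      FreeAlgebra.lift ℝ (fun j => quaternionMap f (a j)) := by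
    ext j <;> simp
  exact DFunLike.congr_fun h p

theorem vecNormSq_quaternionMap (f : S →ₐ[ℝ] T) (q : ℍ[S]) :
    vecNormSq (quaternionMap f q) = f (vecNormSq q) := by
  simp [vecNormSq, quaternionMap_apply]

theorem re_quaternionMap (f : S →ₐ[ℝ] T) (q : ℍ[S]) :
    (quaternionMap f q).re = f q.re := rfl

end QuaternionMap

/-! ### Excluding a nonzero constant ratio by parity -/

section Parity

/-- If finitely many polynomials have pairwise different leading exponents, then a linear
combination of their squares with nonzero coefficients vanishes only if they all vanish. -/
theorem eq_zero_of_sum_sq_eq_zero {σ ι : Type*} [Fintype ι] (o : MonomialOrder σ)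
    (g : ι → MvPolynomial σ ℝ) (c : ι → ℝ) (hc : ∀ i, c i ≠ 0)
    (hg : ∀ i j, i ≠ j → g i ≠ 0 → g j ≠ 0 → o.degree (g i) ≠ o.degree (g j))
    (h : ∑ i, c i • g i ^ 2 = 0) (i : ι) : g i = 0 := by
  classical
  by_contra hi
  obtain ⟨k, hk, hmax⟩ := Finset.exists_max_image (Finset.univ.filter fun j => g j ≠ 0)
    (fun j => o.toSyn (o.degree (g j))) ⟨i, by simpa using hi⟩
  have hk0 : g k ≠ 0 := by simpa using hk
  -- At twice the largest leading exponent only `g k ^ 2` contributes, so nothing can cancel it.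
  have hcoeff := congrArg (coeff (o.degree (g k) + o.degree (g k))) h
  rw [coeff_sum, Finset.sum_eq_single k, coeff_smul, pow_two, o.coeff_mul_of_degree_add] at hcoeff
  · have := o.leadingCoeff_ne_zero_iff.mpr hk0
    simp [hc k, this] at hcoeff
  · intro j _ hjk
    by_cases hj : g j = 0
    · simp [hj]
    have hlt : o.toSyn (o.degree (g j)) < o.toSyn (o.degree (g k)) :=
      lt_of_le_of_ne (hmax j (by simpa using hj))
        fun e => hg j k hjk hj hk0 (o.toSyn.injective e)
    rw [coeff_smul, pow_two, o.coeff_eq_zero_of_lt, smul_zero]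
    refine lt_of_le_of_lt o.degree_mul_le ?_
    rw [map_add, map_add]
    exact add_lt_add hlt hlt
  · simp

/-- The weights recording the parities of the exponents of two variables. -/
def parityWeight : Fin 2 → ZMod 2 × ZMod 2 := ![(1, 0), (0, 1)]

/-- The quaternions over `ℝ[s, t]` whose coordinates have the parities of `1, s, t, s * t`. -/
def paritySubalgebra : Subalgebra ℝ ℍ[MvPolynomial (Fin 2) ℝ] where
  carrier := {q | IsWeightedHomogeneous parityWeight q.re (0, 0) ∧
    IsWeightedHomogeneous parityWeight q.imI (1, 0) ∧
    IsWeightedHomogeneous parityWeight q.imJ (0, 1) ∧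
    IsWeightedHomogeneous parityWeight q.imK (1, 1)}
  -- The basis `1, i, j, k` grades the quaternions by `(ℤ/2)²`, and the parities follow this
  -- grading.
  mul_mem' := by
    rintro a b ⟨a0, a1, a2, a3⟩ ⟨b0, b1, b2, b3⟩
    refine ⟨?_, ?_, ?_, ?_⟩
    · rw [Quaternion.re_mul]
      exact (((a0.mul b0).sub (a1.mul b1)).sub (a2.mul b2)).sub (a3.mul b3)
    · rw [Quaternion.imI_mul]
      exact (((a0.mul b1).add (a1.mul b0)).add (a2.mul b3)).sub (a3.mul b2)
    · rw [Quaternion.imJ_mul]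
      exact (((a0.mul b2).sub (a1.mul b3)).add (a2.mul b0)).add (a3.mul b1)
    · rw [Quaternion.imK_mul]
      exact (((a0.mul b3).add (a1.mul b2)).sub (a2.mul b1)).add (a3.mul b0)
  add_mem' := by
    rintro a b ⟨a0, a1, a2, a3⟩ ⟨b0, b1, b2, b3⟩
    exact ⟨a0.add b0, a1.add b1, a2.add b2, a3.add b3⟩
  algebraMap_mem' r := by
    rw [Algebra.algebraMap_eq_smul_one]
    refine ⟨?_, ?_, ?_, ?_⟩
    · have h := isWeightedHomogeneous_C parityWeight r
      rw [← Prod.mk_zero_zero] at h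
      simpa [smul_eq_C_mul] using h
    all_goals simpa using isWeightedHomogeneous_zero ℝ parityWeight _

/-- The deformation `α + β s i + γ t j + δ s t k` of the quaternion `α + β i + γ j + δ k`. -/
noncomputable def parityLift (q : ℍ[ℝ]) : ℍ[MvPolynomial (Fin 2) ℝ] :=
  ofCoords (C q.re) (C q.imI * X 0) (C q.imJ * X 1) (C q.imK * (X 0 * X 1))

theorem parityLift_mem (q : ℍ[ℝ]) : parityLift q ∈ paritySubalgebra :=
  ⟨isWeightedHomogeneous_C _ _, (isWeightedHomogeneous_X ℝ parityWeight 0).C_mul _,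
    (isWeightedHomogeneous_X ℝ parityWeight 1).C_mul _,
    ((isWeightedHomogeneous_X ℝ parityWeight 0).mul
      (isWeightedHomogeneous_X ℝ parityWeight 1)).C_mul _⟩

theorem quaternionMap_parityLift (q : ℍ[ℝ]) :
    quaternionMap (aeval fun _ => (1 : ℝ)) (parityLift q) = q := by
  ext <;> simp [quaternionMap_apply, parityLift]

theorem lift_mem_of_forall_mem {m : ℕ} {A : Type*} [Ring A] [Algebra ℝ A] (B : Subalgebra ℝ A)
    (a : Fin m → A) (ha : ∀ j, a j ∈ B) (p : NCPoly m) : FreeAlgebra.lift ℝ a p ∈ B := by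
  have h : B.val.comp (FreeAlgebra.lift ℝ fun j => (⟨a j, ha j⟩ : B)) = FreeAlgebra.lift ℝ a := by
    ext j; simp
  rw [← h]
  exact (FreeAlgebra.lift ℝ (fun j => (⟨a j, ha j⟩ : B)) p).2

/-- The four coordinates have distinct parity classes, hence distinct leading exponents, so their
squares cannot cancel. -/
theorem eq_zero_of_mem_paritySubalgebra {q : ℍ[MvPolynomial (Fin 2) ℝ]}
    (hq : q ∈ paritySubalgebra) {c : ℝ} (hc : c ≠ 0) (h : q.re ^ 2 = C c * vecNormSq q) :
    q = 0 := by
  obtain ⟨h0, h1, h2, h3⟩ := hq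
  let o : MonomialOrder (Fin 2) := MonomialOrder.lex
  let e : Fin 4 → ZMod 2 × ZMod 2 := ![(0, 0), (1, 0), (0, 1), (1, 1)]
  let g : Fin 4 → MvPolynomial (Fin 2) ℝ := ![q.re, q.imI, q.imJ, q.imK]
  have hg : ∀ i, IsWeightedHomogeneous parityWeight (g i) (e i) := by
    intro i
    fin_cases i
    exacts [h0, h1, h2, h3]
  have he : Function.Injective e := by decide
  have key := eq_zero_of_sum_sq_eq_zero o g ![1, -c, -c, -c]
    (by intro i; fin_cases i <;> simp [hc])
    (fun i j hij hi hj hd => hij <| he <| by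
      rw [← hg i (o.coeff_degree_ne_zero_iff.mpr hi), ← hg j (o.coeff_degree_ne_zero_iff.mpr hj),
        hd])
    (by
      simp [Fin.sum_univ_four, g, smul_eq_C_mul, h, vecNormSq]
      ring)
  ext1
  exacts [key 0, key 1, key 2, key 3]

/-- A polynomial whose values on `ℍ` all have a scalar part and a vector part with the same nonzero
ratio of squared lengths vanishes on `ℍ`. -/
theorem evalQuaternion_eq_zero_of_re_sq_eq {m : ℕ} (p : NCPoly m) {c : ℝ} (hc : c ≠ 0)
    (h : ∀ a, (evalQuaternion p a).re ^ 2 = c * vecNormSq (evalQuaternion p a))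
    (a : Fin m → ℍ[ℝ]) : evalQuaternion p a = 0 := by
  have hmem := lift_mem_of_forall_mem paritySubalgebra (fun j => parityLift (a j))
    (fun j => parityLift_mem _) p
  have hzero := eq_zero_of_mem_paritySubalgebra hmem hc <| by
    refine MvPolynomial.funext fun x => ?_
    have hx := h fun j => quaternionMap (aeval x) (parityLift (a j))
    rw [evalQuaternion, ← quaternionMap_lift, vecNormSq_quaternionMap, re_quaternionMap] at hx
    simpa [aeval_eq_eval] using hx
  -- Setting `s = t = 1` recovers the original arguments.
  have h1 := quaternionMap_lift (aeval fun _ => (1 : ℝ)) (fun j => parityLift (a j)) p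
  rw [hzero, map_zero] at h1
  simpa [quaternionMap_parityLift, evalQuaternion] using h1.symm

end Parity

/-! ### Conjugation and scaling of the image -/

section Orbits

theorem vecNormSq_nonneg (q : ℍ[ℝ]) : 0 ≤ vecNormSq q := by
  unfold vecNormSq; positivity

theorem vecNormSq_eq_zero {q : ℍ[ℝ]} (h : vecNormSq q = 0) :
    q.imI = 0 ∧ q.imJ = 0 ∧ q.imK = 0 := by
  unfold vecNormSq at h
  refine ⟨?_, ?_, ?_⟩ <;> nlinarith [sq_nonneg q.imI, sq_nonneg q.imJ, sq_nonneg q.imK]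

theorem vecNormSq_smul (t : ℝ) (q : ℍ[ℝ]) : vecNormSq (t • q) = t ^ 2 * vecNormSq q := by
  simp [vecNormSq]; ring

/-- Quaternions with equal scalar parts and vector parts of equal length are conjugate. -/
theorem exists_conj_eq {q q' : ℍ[ℝ]} (hre : q'.re = q.re) (hvec : vecNormSq q' = vecNormSq q) :
    ∃ g : ℍ[ℝ], g ≠ 0 ∧ g * q = q' * g := by
  unfold vecNormSq at hvec
  by_cases hw : q.im + q'.im = 0
  · have e1 : q'.imI = -q.imI := by
      have := congrArg QuaternionAlgebra.imI hw; simp at this; linarith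
    have e2 : q'.imJ = -q.imJ := by
      have := congrArg QuaternionAlgebra.imJ hw; simp at this; linarith
    have e3 : q'.imK = -q.imK := by
      have := congrArg QuaternionAlgebra.imK hw; simp at this; linarith
    -- The vector parts are opposite: any nonzero vector orthogonal to `q.im` anticommutes with it
    -- and serves as `g`.
    by_cases h0 : q.imI = 0 ∧ q.imJ = 0
    · refine ⟨ofCoords 0 1 0 0, fun h => by simpa using congrArg QuaternionAlgebra.imI h, ?_⟩
      ext <;> simp [hre, e1, e2, e3, h0.1, h0.2]
    · refine ⟨ofCoords 0 (-q.imJ) q.imI 0, fun h => h0 ⟨?_, ?_⟩, ?_⟩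
      · simpa using congrArg QuaternionAlgebra.imJ h
      · simpa using congrArg QuaternionAlgebra.imI h
      · ext <;> simp [hre, e1, e2, e3] <;> ring
  -- With `v`, `v'` the vector parts, `(v + v') v = v' (v + v')` because `v² = v'²`.
  · refine ⟨q.im + q'.im, hw, ?_⟩
    ext <;> simp [hre] <;> linarith

variable {m : ℕ} {w : Fin m → ℤ} {d : ℤ} {p : NCPoly m}

theorem mem_quaternionImage_of_conj {q q' : ℍ[ℝ]} (hq : q ∈ quaternionImage p)
    (hre : q'.re = q.re) (hvec : vecNormSq q' = vecNormSq q) : q' ∈ quaternionImage p := by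
  obtain ⟨g, hg, hgq⟩ := exists_conj_eq hre hvec
  obtain ⟨a, rfl⟩ := hq
  let u : ℍ[ℝ]ˣ := Units.mk0 g hg
  let φ : ℍ[ℝ] →ₐ[ℝ] ℍ[ℝ] := (MulSemiringAction.toAlgHom ℝ ℍ[ℝ] (ConjAct.toConjAct u))
  have hφ : ∀ x, φ x = g * x * g⁻¹ := fun x => by
    simp [φ, ConjAct.units_smul_def, u]
  refine ⟨fun j => φ (a j), ?_⟩
  have h : φ.comp (FreeAlgebra.lift ℝ a) = FreeAlgebra.lift ℝ (fun j => φ (a j)) := by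
    ext1; funext j; simp
  rw [evalQuaternion, ← h, AlgHom.comp_apply, hφ]
  change g * evalQuaternion p a * g⁻¹ = q'
  rw [hgq, mul_assoc, mul_inv_cancel₀ hg, mul_one]

theorem lift_smul_freeMonoid (w : Fin m → ℤ) {t : ℝ} (ht : t ≠ 0) (a : Fin m → ℍ[ℝ])
    (h : FreeMonoid (Fin m)) :
    FreeMonoid.lift (fun j => t ^ w j • a j) h =
      t ^ (∑ j, (monomialDegree j h : ℤ) * w j) • FreeMonoid.lift a h := by
  induction h using FreeMonoid.inductionOn' with
  | one => simp [monomialDegree]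
  | of_mul x xs ih =>
    have hdeg : ∀ j, (monomialDegree j (FreeMonoid.of x * xs) : ℤ) * w j =
        (if x = j then w j else 0) + (monomialDegree j xs : ℤ) * w j := by
      intro j
      by_cases hj : x = j <;> simp [monomialDegree, hj, add_mul, add_comm]
    simp only [map_mul, FreeMonoid.lift_eval_of, ih, hdeg, Finset.sum_add_distrib,
      Finset.sum_ite_eq, Finset.mem_univ, if_true, zpow_add₀ ht, smul_mul_smul_comm]

theorem evalQuaternion_eq_sum (p : NCPoly m) (a : Fin m → ℍ[ℝ]) :
    evalQuaternion p a = ∑ h ∈ NCPoly.monomials p,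
      (FreeAlgebra.equivMonoidAlgebraFreeMonoid p).coeff h • FreeMonoid.lift a h := by
  have h : (FreeAlgebra.lift ℝ a) = (MonoidAlgebra.lift ℝ ℍ[ℝ] _ (FreeMonoid.lift a)).comp
      (FreeAlgebra.equivMonoidAlgebraFreeMonoid (R := ℝ) (X := Fin m)).toAlgHom := by
    ext1; funext j; simp [FreeAlgebra.equivMonoidAlgebraFreeMonoid]
  rw [evalQuaternion, h, AlgHom.comp_apply, MonoidAlgebra.lift_apply]
  rfl

theorem evalQuaternion_smul (hp : IsSemihomogeneous w d p) {t : ℝ} (ht : t ≠ 0)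
    (a : Fin m → ℍ[ℝ]) :
    evalQuaternion p (fun j => t ^ w j • a j) = t ^ d • evalQuaternion p a := by
  rw [evalQuaternion_eq_sum, evalQuaternion_eq_sum, Finset.smul_sum]
  refine Finset.sum_congr rfl fun h hh => ?_
  rw [lift_smul_freeMonoid w ht, hp h hh, smul_comm]

/-- Scaling fixes the zero tuple, so `p(0) = 2 ^ d • p(0)` with `2 ^ d ≠ 1`. -/
theorem zero_mem_quaternionImage (hd : d ≠ 0) (hp : IsSemihomogeneous w d p) :
    0 ∈ quaternionImage p := by
  refine ⟨0, ?_⟩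
  have h := evalQuaternion_smul hp (two_ne_zero (α := ℝ)) 0
  have h0 : (fun j => (2 : ℝ) ^ w j • (0 : Fin m → ℍ[ℝ]) j) = 0 := by ext1; simp
  rw [h0] at h
  have h1 : (1 - (2 : ℝ) ^ d) • evalQuaternion p 0 = 0 := by
    rw [sub_smul, one_smul, ← h, sub_self]
  refine (smul_eq_zero.mp h1).resolve_left fun h2 => hd ?_
  exact (zpow_eq_one_iff_right₀ (by norm_num) (by norm_num)).mp (sub_eq_zero.mp h2).symm

theorem smul_mem_quaternionImage (hd : d ≠ 0) (hp : IsSemihomogeneous w d p) {t : ℝ} (ht : 0 < t)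
    {q : ℍ[ℝ]} (hq : q ∈ quaternionImage p) : t • q ∈ quaternionImage p := by
  obtain ⟨a, rfl⟩ := hq
  refine ⟨fun j => (t ^ (d : ℝ)⁻¹) ^ w j • a j, ?_⟩
  rw [evalQuaternion_smul hp (Real.rpow_pos_of_pos ht _).ne', ← Real.rpow_intCast,
    Real.rpow_inv_rpow ht.le (by exact_mod_cast hd)]

end Orbits

/-! ### Infinitely many ratios against finitely many -/

section Density

/-- A set of quaternions stable under positive scaling and conjugation in which the ratios of the
scalar part to the length of the vector part take infinitely many values is Zariski dense. -/
theorem isZariskiDense_of_infinite {S : Set ℍ[ℝ]}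
    (hsmul : ∀ t : ℝ, 0 < t → ∀ q ∈ S, t • q ∈ S)
    (hconj : ∀ q ∈ S, ∀ q' : ℍ[ℝ], q'.re = q.re → vecNormSq q' = vecNormSq q → q' ∈ S)
    (hinf : ((fun q : ℍ[ℝ] => q.re / √(vecNormSq q)) '' {q ∈ S | vecNormSq q ≠ 0}).Infinite) :
    IsZariskiDense S := by
  rintro Z ⟨F, rfl⟩ hS
  refine Set.eq_univ_of_forall fun q f hf => ?_
  have hfS : ∀ a b c d : ℝ, ofCoords a b c d ∈ S → eval ![a, b, c, d] f = 0 :=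
    fun a b c d h => hS h f hf
  have main : ∀ a b c d : ℝ, b ^ 2 + c ^ 2 + d ^ 2 ≠ 0 → eval ![a, b, c, d] f = 0 := by
    intro a b c d hN
    have hpos : 0 < b ^ 2 + c ^ 2 + d ^ 2 := lt_of_le_of_ne (by positivity) hN.symm
    set ρ := √(b ^ 2 + c ^ 2 + d ^ 2) with hρ
    have hρ0 : 0 < ρ := Real.sqrt_pos.mpr hpos
    let g : Polynomial ℝ := aeval ![Polynomial.X, .C b, .C c, .C d] f
    -- Fix the vector part and vary the scalar part: each ratio, times `ρ`, is a root of `g`.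
    have hg : ∀ x, g.eval x = eval ![x, b, c, d] f := by
      intro x
      rw [← Polynomial.coe_aeval_eq_eval, ← MvPolynomial.coe_aeval_eq_eval]
      change ((Polynomial.aeval x).comp (MvPolynomial.aeval _)) f = aeval _ f
      rw [MvPolynomial.comp_aeval]
      refine congrArg (fun v => aeval v f) ?_
      funext i
      fin_cases i <;> simp
    have hg0 : g = 0 := by
      refine Polynomial.eq_zero_of_infinite_isRoot g
        ((hinf.image (f := fun x => ρ * x) fun x _ y _ h =>
          mul_left_cancel₀ hρ0.ne' h).mono ?_)
      rintro _ ⟨_, ⟨q, ⟨hq, hqN⟩, rfl⟩, rfl⟩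
      change g.eval _ = 0
      rw [hg]
      have hq0 : 0 < √(vecNormSq q) :=
        Real.sqrt_pos.mpr (lt_of_le_of_ne (vecNormSq_nonneg q) hqN.symm)
      refine hfS _ _ _ _ (hconj _ (hsmul (ρ / √(vecNormSq q)) (by positivity) q hq) _ ?_ ?_)
      · simp; ring
      · rw [vecNormSq_smul, div_pow, Real.sq_sqrt (vecNormSq_nonneg q), Real.sq_sqrt hpos.le,
          div_mul_cancel₀ _ hqN]
        rfl
    rw [← hg, hg0, Polynomial.eval_zero]
  by_cases hN : vecNormSq q = 0
  · obtain ⟨h1, h2, h3⟩ := vecNormSq_eq_zero hN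
    rw [h1, h2, h3]
    -- Scalars lie on the line where only `imI` varies; `main` gives roots at all `x > 0`.
    let g : Polynomial ℝ := aeval ![.C q.re, Polynomial.X, 0, 0] f
    have hg : ∀ x, g.eval x = eval ![q.re, x, 0, 0] f := by
      intro x
      rw [← Polynomial.coe_aeval_eq_eval, ← MvPolynomial.coe_aeval_eq_eval]
      change ((Polynomial.aeval x).comp (MvPolynomial.aeval _)) f = aeval _ f
      rw [MvPolynomial.comp_aeval]
      refine congrArg (fun v => aeval v f) ?_
      funext i
      fin_cases i <;> simp
    have hg0 : g = 0 := by
      refine Polynomial.eq_zero_of_infinite_isRoot g ((Set.Ioi_infinite (0 : ℝ)).mono fun x hx => ?_)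
      change g.eval _ = 0
      rw [hg]
      refine main _ _ _ _ ?_
      have : 0 < x := hx
      positivity
    rw [← hg, hg0, Polynomial.eval_zero]
  · exact main _ _ _ _ hN

/-- If the ratio of the scalar part to the length of the vector part takes finitely many values on
the image of `p`, then it is constant up to sign, or the image consists of scalars. -/
theorem vecNormSq_eq_zero_or_re_sq_eq_of_finite {m : ℕ} (p : NCPoly m)
    (hfin : ((fun q : ℍ[ℝ] => q.re / √(vecNormSq q)) ''
      {q ∈ quaternionImage p | vecNormSq q ≠ 0}).Finite) :
    (∀ a, vecNormSq (evalQuaternion p a) = 0) ∨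
    ∃ c : ℝ, ∀ a, (evalQuaternion p a).re ^ 2 = c * vecNormSq (evalQuaternion p a) := by
  let G : Fin m → ℍ[MvPolynomial (Fin m × Fin 4) ℝ] := fun j =>
    ofCoords (X (j, 0)) (X (j, 1)) (X (j, 2)) (X (j, 3))
  let P := FreeAlgebra.lift ℝ G p
  have heval : ∀ e : Fin m × Fin 4 → ℝ, quaternionMap (aeval e) P =
      evalQuaternion p fun j => ofCoords (e (j, 0)) (e (j, 1)) (e (j, 2)) (e (j, 3)) := by
    intro e
    refine (quaternionMap_lift _ _ _).trans (congrArg (evalQuaternion p) ?_)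
    funext j
    ext <;> simp [quaternionMap_apply, G]
  have hcoord : ∀ a : Fin m → ℍ[ℝ], ∃ e : Fin m × Fin 4 → ℝ,
      evalQuaternion p a = quaternionMap (aeval e) P := by
    intro a
    refine ⟨fun x => ![(a x.1).re, (a x.1).imI, (a x.1).imJ, (a x.1).imK] x.2, ?_⟩
    rw [heval]
    rfl
  -- The factor `vecNormSq P` handles the scalar values, where no ratio is available.
  have hprod : vecNormSq P * ∏ x ∈ hfin.toFinset, (P.re ^ 2 - C (x ^ 2) * vecNormSq P) = 0 := by
    refine MvPolynomial.funext fun e => ?_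
    rw [map_mul, map_prod, map_zero, mul_eq_zero, or_iff_not_imp_left]
    intro hN
    rw [← coe_aeval_eq_eval] at hN ⊢
    replace hN : vecNormSq (quaternionMap (aeval e) P) ≠ 0 := by
      rwa [vecNormSq_quaternionMap]
    refine Finset.prod_eq_zero (i := (quaternionMap (aeval e) P).re /
      √(vecNormSq (quaternionMap (aeval e) P))) ?_ ?_
    · rw [Set.Finite.mem_toFinset]
      exact ⟨_, ⟨⟨_, (heval e).symm⟩, hN⟩, rfl⟩
    · change aeval e _ = 0
      rw [map_sub, map_mul, map_pow, ← vecNormSq_quaternionMap, ← re_quaternionMap, aeval_C,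
        div_pow, Real.sq_sqrt (vecNormSq_nonneg _), Algebra.algebraMap_self, RingHom.id_apply,
        div_mul_cancel₀ _ hN, sub_self]
  rcases mul_eq_zero.mp hprod with h | h
  · left
    intro a
    obtain ⟨e, he⟩ := hcoord a
    rw [he, vecNormSq_quaternionMap, h, map_zero]
  · right
    obtain ⟨x, -, hx⟩ := Finset.prod_eq_zero_iff.mp h
    refine ⟨x ^ 2, fun a => ?_⟩
    obtain ⟨e, he⟩ := hcoord a
    rw [he, vecNormSq_quaternionMap, re_quaternionMap, ← map_pow, sub_eq_zero.mp hx, map_mul,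
      aeval_C]
    rfl

end Density

/-! ### Cones of scalars and of vectors -/

section Cones

theorem cone_of_scalars {S : Set ℍ[ℝ]} (h0 : 0 ∈ S)
    (hsmul : ∀ t : ℝ, 0 < t → ∀ q ∈ S, t • q ∈ S) (hS : S ⊆ scalarQuaternions) :
    S = {0} ∨ S = scalarQuaternions ∨ S = nonnegScalarQuaternions ∨
      S = nonposScalarQuaternions := by
  have hray : ∀ r s : ℝ, (r : ℍ[ℝ]) ∈ S → 0 < s / r → (s : ℍ[ℝ]) ∈ S := by
    intro r s hr hs
    have hr0 : r ≠ 0 := by rintro rfl; simp at hs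
    have := hsmul _ hs _ hr
    rwa [← Quaternion.coe_smul, smul_eq_mul, div_mul_cancel₀ _ hr0] at this
  by_cases hpos : ∃ r : ℝ, 0 < r ∧ (r : ℍ[ℝ]) ∈ S <;>
    by_cases hneg : ∃ r : ℝ, r < 0 ∧ (r : ℍ[ℝ]) ∈ S
  · obtain ⟨r, hr, hrS⟩ := hpos
    obtain ⟨s, hs, hsS⟩ := hneg
    refine Or.inr (Or.inl (hS.antisymm ?_))
    rintro _ ⟨x, rfl⟩
    rcases lt_trichotomy x 0 with hx | rfl | hx
    · exact hray s x hsS (div_pos_of_neg_of_neg hx hs)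
    · simpa using h0
    · exact hray r x hrS (div_pos hx hr)
  · obtain ⟨r, hr, hrS⟩ := hpos
    push Not at hneg
    refine Or.inr (Or.inr (Or.inl (Set.Subset.antisymm (fun q hq => ?_) ?_)))
    · obtain ⟨x, rfl⟩ := hS hq
      exact ⟨x, not_lt.mp fun hx => hneg x hx hq, rfl⟩
    · rintro _ ⟨x, hx, rfl⟩
      rcases (Set.mem_Ici.mp hx).eq_or_lt with rfl | hx
      · simpa using h0
      · exact hray r x hrS (div_pos hx hr)
  · obtain ⟨r, hr, hrS⟩ := hneg
    push Not at hpos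
    refine Or.inr (Or.inr (Or.inr (Set.Subset.antisymm (fun q hq => ?_) ?_)))
    · obtain ⟨x, rfl⟩ := hS hq
      exact ⟨x, not_lt.mp fun hx => hpos x hx hq, rfl⟩
    · rintro _ ⟨x, hx, rfl⟩
      rcases (Set.mem_Iic.mp hx).eq_or_lt with rfl | hx
      · simpa using h0
      · exact hray r x hrS (div_pos_of_neg_of_neg hx hr)
  · push Not at hpos hneg
    refine Or.inl (Set.Subset.antisymm (fun q hq => ?_) (by simpa using h0))
    obtain ⟨x, rfl⟩ := hS hq
    rcases lt_trichotomy x 0 with hx | rfl | hx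
    · exact absurd hq (hneg x hx)
    · simp
    · exact absurd hq (hpos x hx)

theorem cone_of_vectors {S : Set ℍ[ℝ]} (h0 : 0 ∈ S)
    (hsmul : ∀ t : ℝ, 0 < t → ∀ q ∈ S, t • q ∈ S)
    (hconj : ∀ q ∈ S, ∀ q' : ℍ[ℝ], q'.re = q.re → vecNormSq q' = vecNormSq q → q' ∈ S)
    (hS : S ⊆ vectorQuaternions) : S = {0} ∨ S = vectorQuaternions := by
  have hzero : ∀ q ∈ vectorQuaternions, vecNormSq q = 0 → q = 0 := by
    intro q hq hN
    obtain ⟨h1, h2, h3⟩ := vecNormSq_eq_zero hN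
    exact Quaternion.ext _ _ hq h1 h2 h3
  by_cases h : ∃ q ∈ S, q ≠ 0
  · obtain ⟨q, hq, hne⟩ := h
    have hqN : vecNormSq q ≠ 0 := fun h => hne (hzero q (hS hq) h)
    have hq0 : 0 < √(vecNormSq q) :=
      Real.sqrt_pos.mpr (lt_of_le_of_ne (vecNormSq_nonneg q) hqN.symm)
    refine Or.inr (hS.antisymm fun v hv => ?_)
    by_cases hvN : vecNormSq v = 0
    · rwa [hzero v hv hvN]
    have hv0 : 0 < √(vecNormSq v) :=
      Real.sqrt_pos.mpr (lt_of_le_of_ne (vecNormSq_nonneg v) (Ne.symm hvN))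
    refine hconj _ (hsmul (√(vecNormSq v) / √(vecNormSq q)) (by positivity) q hq) v ?_ ?_
    · have h1 : v.re = 0 := hv
      have h2 : q.re = 0 := hS hq
      simp [h1, h2]
    · rw [vecNormSq_smul, div_pow, Real.sq_sqrt (vecNormSq_nonneg q),
        Real.sq_sqrt (vecNormSq_nonneg v), div_mul_cancel₀ _ hqN]
  · push Not at h
    exact Or.inl (Set.Subset.antisymm (fun q hq => h q hq) (by simpa using h0))

end Cones

theorem theorem2 {m : ℕ} (w : Fin m → ℤ) (d : ℤ) (hd : d ≠ 0) (p : NCPoly m)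
    (hp : IsSemihomogeneous w d p) :
    quaternionImage p = {0} ∨
    quaternionImage p = scalarQuaternions ∨
    quaternionImage p = nonnegScalarQuaternions ∨
    quaternionImage p = nonposScalarQuaternions ∨
    quaternionImage p = vectorQuaternions ∨
    IsZariskiDense (quaternionImage p) := by
  have h0 := zero_mem_quaternionImage hd hp
  have hsmul : ∀ t : ℝ, 0 < t → ∀ q ∈ quaternionImage p, t • q ∈ quaternionImage p :=
    fun t ht q hq => smul_mem_quaternionImage hd hp ht hq
  have hconj : ∀ q ∈ quaternionImage p, ∀ q' : ℍ[ℝ], q'.re = q.re →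
      vecNormSq q' = vecNormSq q → q' ∈ quaternionImage p :=
    fun q hq q' => mem_quaternionImage_of_conj hq
  by_cases hfin : ((fun q : ℍ[ℝ] => q.re / √(vecNormSq q)) ''
      {q ∈ quaternionImage p | vecNormSq q ≠ 0}).Finite
  · rcases vecNormSq_eq_zero_or_re_sq_eq_of_finite p hfin with h | ⟨c, hc⟩
    · have hS : quaternionImage p ⊆ scalarQuaternions := by
        rintro _ ⟨a, rfl⟩
        obtain ⟨h1, h2, h3⟩ := vecNormSq_eq_zero (h a)
        exact ⟨(evalQuaternion p a).re, by ext <;> simp [h1, h2, h3]⟩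
      have := cone_of_scalars h0 hsmul hS
      tauto
    · rcases eq_or_ne c 0 with rfl | hc0
      · have hS : quaternionImage p ⊆ vectorQuaternions := by
          rintro _ ⟨a, rfl⟩
          have := hc a
          rw [zero_mul] at this
          exact pow_eq_zero_iff two_ne_zero |>.mp this
        have := cone_of_vectors h0 hsmul hconj hS
        tauto
      · refine Or.inl (Set.Subset.antisymm ?_ (by simpa using h0))
        rintro _ ⟨a, rfl⟩
        exact evalQuaternion_eq_zero_of_re_sq_eq p hc0 hc a
  · have := isZariskiDense_of_infinite hsmul hconj hfin
    tauto
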